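/- Let $n\ge 1$ be an integer and $[n]=\{1,\dots,n\}$. A preference list $\pi=(\pi_1,\dots,\pi_n)\in[n]^n$ is a classical parking function if, when cars $1,\dots,n$ enter in this order a one-way street with spots $1,\dots,n$ and each car $i$ parks in the first spot $\ge\pi_i$ that is not yet occupied, all cars succeed in parking. Put $\mathrm{lel}(\pi)=\#\{j:\pi_j=\pi_1\}$ and $\mathrm{ones}(\pi)=\#\{j:\pi_j=1\}$. The preference partition of $\pi$ is the set partition of $[n]$ whose blocks are the non-empty sets among $B_\pi(i)=\{j:\pi_j=i\}$, $i\in[n]$. The reduced preference partition of $\pi$ is obtained from it by merging $B_\pi(1)$ and $B_\pi(\pi_1)$ into the single block $B_\pi(1)\cup B_\pi(\pi_1)$ (so it is the preference partition itself if $\pi_1=1$). Theorem. Fix a set partition $\mathcal P$ of $[n]$. Then $\mathrm{lel}(\pi)$ and $\mathrm{ones}(\pi)$ have a symmetric joint distribution over all classical parking functions $\pi$ whose reduced preference partition is $\mathcal P$; that is, for all integers $s,t\ge 0$, the number of such $\pi$ with $\mathrm{lel}(\pi)=s$ and $\mathrm{ones}(\pi)=t$ equals the number of such $\pi$ with $\mathrm{lel}(\pi)=t$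 and $\mathrm{ones}(\pi)=s$. -/

import Mathlib

/-- The parking process. `m` cars (labelled by `Fin m`, in order of arrival) enter a one-way street
with `n` spots (labelled by `Fin n`, in consecutive order); car `i` prefers the spot `π i`.
`IsParkingOutcome π σ` says that every car `i` succeeds in parking, in the spot `σ i`: this is the
first spot, from `π i` onwards, that is not occupied by one of the cars that arrived earlier. -/
def IsParkingOutcome {m n : ℕ} (π σ : Fin m → Fin n) : Prop :=
  ∀ i, IsLeast {s : Fin n | π i ≤ s ∧ ∀ j, j < i → σ j ≠ s} (σ i)

/-- The preference list `π` is a parking function: all cars successfully park. It is a *classical*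
parking function when `m = n`. -/
def IsParkingFunction {m n : ℕ} (π : Fin m → Fin n) : Prop :=
  ∃ σ : Fin m → Fin n, IsParkingOutcome π σ

/-- `B_π(i)`: the set of cars that prefer the spot `i`. -/
def preferenceBlock {n : ℕ} (π : Fin n → Fin n) (i : Fin n) : Finset (Fin n) :=
  Finset.univ.filter fun j => π j = i

theorem mem_preferenceBlock {n : ℕ} {π : Fin n → Fin n} {i j : Fin n} :
    j ∈ preferenceBlock π i ↔ π j = i := by
  simp [preferenceBlock]

/-- The preference partition of `π`: its blocks are the non-empty `B_π(i)`. -/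
def preferencePartition {n : ℕ} (π : Fin n → Fin n) :
    Finpartition (Finset.univ : Finset (Fin n)) where
  parts := (Finset.univ.image (preferenceBlock π)).erase ∅
  supIndep := by
    rw [Finset.supIndep_iff_pairwiseDisjoint]
    intro a ha b hb hab
    simp only [Finset.coe_erase, Finset.coe_image, Finset.coe_univ, Set.image_univ,
      Set.mem_sdiff, Set.mem_range, Set.mem_singleton_iff] at ha hb
    obtain ⟨⟨i, rfl⟩, -⟩ := ha
    obtain ⟨⟨k, rfl⟩, -⟩ := hb
    refine Finset.disjoint_left.2 fun j hj hj' => hab ?_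
    simp only [id, mem_preferenceBlock] at hj hj'
    rw [← hj, ← hj']
  sup_parts := by
    refine Finset.eq_univ_of_forall fun j => ?_
    have hj : j ∈ preferenceBlock π (π j) := mem_preferenceBlock.2 rfl
    refine Finset.mem_sup.2 ⟨preferenceBlock π (π j), ?_, hj⟩
    exact Finset.mem_erase.2 ⟨Finset.ne_empty_of_mem hj,
      Finset.mem_image_of_mem _ (Finset.mem_univ _)⟩
  bot_notMem := by simp

/-- The reduced preference partition of `π`: in the preference partition, the block of the cars
preferring the first spot and the block of the cars preferring the same spot as the first car are
merged into one block. In `Fin n`, the element `0` stands for the first spot and for the first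
car. -/
def reducedPreferencePartition {n : ℕ} [NeZero n] (π : Fin n → Fin n) :
    Finpartition (Finset.univ : Finset (Fin n)) where
  parts := insert (preferenceBlock π 0 ∪ preferenceBlock π (π 0))
    ((preferencePartition π).parts \ {preferenceBlock π 0, preferenceBlock π (π 0)})
  supIndep := by
    have key : ∀ b ∈ (preferencePartition π).parts \
        {preferenceBlock π 0, preferenceBlock π (π 0)},
        Disjoint (preferenceBlock π 0 ∪ preferenceBlock π (π 0)) b := by
      intro b hb
      simp only [preferencePartition, Finset.mem_sdiff, Finset.mem_erase, Finset.mem_image,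
        Finset.mem_univ, true_and, Finset.mem_insert, Finset.mem_singleton, not_or] at hb
      obtain ⟨⟨-, k, rfl⟩, h0, h1⟩ := hb
      refine Finset.disjoint_left.2 fun j hj hj' => ?_
      rw [mem_preferenceBlock] at hj'
      rw [Finset.mem_union, mem_preferenceBlock, mem_preferenceBlock] at hj
      rcases hj with hj | hj
      · exact h0 (by rw [← hj', hj])
      · exact h1 (by rw [← hj', hj])
    rw [Finset.supIndep_iff_pairwiseDisjoint, Finset.coe_insert]
    refine Set.PairwiseDisjoint.insert ?_ fun b hb _ => key b hb
    exact (preferencePartition π).disjoint.subset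
      (Finset.coe_subset.2 Finset.sdiff_subset)
  sup_parts := by
    refine Finset.eq_univ_of_forall fun j => ?_
    have hj : j ∈ preferenceBlock π (π j) := mem_preferenceBlock.2 rfl
    rw [Finset.sup_insert, Finset.sup_eq_union, Finset.mem_union]
    by_cases h : preferenceBlock π (π j) ∈
        ({preferenceBlock π 0, preferenceBlock π (π 0)} : Finset (Finset (Fin n)))
    · left
      rw [Finset.mem_insert, Finset.mem_singleton] at h
      rcases h with h | h
      · exact Finset.mem_union_left _ (h ▸ hj)
      · exact Finset.mem_union_right _ (h ▸ hj)
    · right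
      refine Finset.mem_sup.2 ⟨preferenceBlock π (π j), Finset.mem_sdiff.2 ⟨?_, h⟩, hj⟩
      exact Finset.mem_erase.2 ⟨Finset.ne_empty_of_mem hj,
        Finset.mem_image_of_mem _ (Finset.mem_univ _)⟩
  bot_notMem := by
    intro h
    rcases Finset.mem_insert.1 h with h | h
    · have h0 : (0 : Fin n) ∈ preferenceBlock π 0 ∪ preferenceBlock π (π 0) :=
        Finset.mem_union_right _ (mem_preferenceBlock.2 rfl)
      rw [← h] at h0
      exact absurd h0 (Finset.notMem_empty _)
    · exact (preferencePartition π).bot_notMem (Finset.mem_sdiff.1 h).1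

/-- Leading elements: the number of cars whose preferred spot is the same as that of the first
car. -/
def lel {n : ℕ} [NeZero n] (π : Fin n → Fin n) : ℕ :=
  (Finset.univ.filter fun j => π j = π 0).card

/-- The `1`'s statistic: the number of cars that prefer the first spot (the element `0` of
`Fin n`). -/
def ones {n : ℕ} [NeZero n] (π : Fin n → Fin n) : ℕ :=
  (Finset.univ.filter fun j => π j = 0).card

/-! If `π 0 = 0`, the two statistics agree, so only `s ≠ t` matters, and then `π 0 ≠ 0`. The cars
preferring the first spot form a set `B` of size `t`. With the cars preferring `π 0`, they make up
the block of `P` containing car `0`, so both counts vanish unless that block has `r = s + t`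
elements. Fix `B`. Giving the cars of `B` the preference `π 0` vacates the first spot; shifting down
by one leaves a labeling of the blocks of `P` by distinct spots, and parking becomes a condition on
final segments (`card_isParkingFunction_of_block`). By the cycle lemma, exactly `B.card` of the `n`
rotations of any labeling satisfy it, so the proportion of good labelings is `t / n`, whatever `P`
is (`mul_card_isUnderfull`). Summing over the possible `B` gives a count proportional to `(r -
1).choose t * t = (r - 1)! / ((s - 1)! (t - 1)!)` for `s, t ≥ 1`, which is symmetric; if `s` or `t`
is zero, both counts vanish. -/

/-! ### Counting criterion for parking functions -/

/-- A preference list is a parking function iff, for every `p`, at most `n - p` cars prefer one of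
the last `n - p` spots. -/
theorem isParkingFunction_iff {m n : ℕ} (π : Fin m → Fin n) :
    IsParkingFunction π ↔
      ∀ p ≤ n, (Finset.univ.filter fun j => p ≤ (π j).val).card + p ≤ n := by
  constructor
  · rintro ⟨σ, hσ⟩ p hp
    have hinj : Function.Injective σ := by
      intro i j hij
      rcases lt_trichotomy i j with h | h | h
      · exact absurd hij ((hσ j).1.2 i h)
      · exact h
      · exact absurd hij.symm ((hσ i).1.2 j h)
    have h1 : (Finset.univ.filter fun j => p ≤ (π j).val).card ≤ (Finset.Ico p n).card := by
      refine Finset.card_le_card_of_injOn (fun j => (σ j).val) ?_ ?_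
      · intro j hj
        simp only [Finset.coe_filter, Finset.mem_univ, true_and, Set.mem_ofPred_eq] at hj
        simp only [Finset.coe_Ico, Set.mem_Ico]
        exact ⟨hj.trans (hσ j).1.1, (σ j).isLt⟩
      · intro i _ j _ hij
        exact hinj (Fin.ext hij)
    rw [Nat.card_Ico] at h1
    omega
  · induction m with
    | zero => intro _; exact ⟨Fin.elim0, fun i => i.elim0⟩
    | succ m ih =>
      intro h
      obtain ⟨σ, hσ⟩ := ih (fun i => π i.castSucc) (by
        intro p hp
        refine le_trans (Nat.add_le_add_right ?_ p) (h p hp)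
        refine Finset.card_le_card_of_injOn Fin.castSucc ?_ (Fin.castSucc_injective m).injOn
        intro j hj
        simpa using hj)
      have hfree : ∃ s : Fin n, π (Fin.last m) ≤ s ∧ ∀ j, σ j ≠ s := by
        by_contra hno
        push Not at hno
        -- Take `p` least such that all spots from `p` on are taken. A car parked there but
        -- preferring an earlier spot would have passed `p - 1`, so `p - 1` would be taken too.
        -- Hence `n - p` earlier cars prefer spots from `p` on, and the last car is one too many.
        have hex : ∃ p : ℕ, p ≤ (π (Fin.last m)).val ∧ ∀ s : Fin n, p ≤ s.val → ∃ j, σ j = s :=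
          ⟨_, le_rfl, hno⟩
        classical
        obtain ⟨hp1, hp2⟩ := Nat.find_spec hex
        have hmin := fun q => Nat.find_min (H := hex) (m := q)
        generalize Nat.find hex = p at hp1 hp2 hmin
        have hpn : p < n := hp1.trans_lt (π (Fin.last m)).isLt
        have hpref : ∀ j, p ≤ (σ j).val → p ≤ (π j.castSucc).val := by
          intro j hj
          by_contra hlt
          have hlt : (π j.castSucc).val < p := not_le.1 hlt
          refine hmin (p - 1) (by omega) ⟨by omega, fun s hs => ?_⟩
          rcases Nat.lt_or_ge s.val p with hsp | hsp
          · by_contra hs'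
            push Not at hs'
            have hle : σ j ≤ s := (hσ j).2 ⟨by
              change (π j.castSucc).val ≤ s.val
              omega, fun i _ => hs' i⟩
            have : (σ j).val ≤ s.val := hle
            omega
          · exact hp2 s hsp
        have : Nonempty (Fin m) := ⟨(hp2 ⟨p, hpn⟩ le_rfl).choose⟩
        choose! g hg using hp2
        have hcard : (Finset.univ.filter fun s : Fin n => p ≤ s.val).card ≤
            (Finset.univ.filter fun j : Fin m => p ≤ (π j.castSucc).val).card := by
          refine Finset.card_le_card_of_injOn g ?_ ?_
          · intro s hs
            simp only [Finset.coe_filter, Finset.mem_univ, true_and, Set.mem_ofPred_eq] at hs ⊢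
            exact hpref _ (by rw [hg s hs]; exact hs)
          · intro s hs s' hs' he
            simp only [Finset.coe_filter, Finset.mem_univ, true_and, Set.mem_ofPred_eq] at hs hs'
            rw [← hg s hs, ← hg s' hs', he]
        have hspots : (Finset.univ.filter fun s : Fin n => p ≤ s.val).card = n - p := by
          have := Fin.card_Ici (⟨p, hpn⟩ : Fin n)
          rw [← this]
          congr 1
          ext s
          simp [Fin.le_def]
        have htot := h p hpn.le
        rw [Fin.univ_castSuccEmb, Finset.filter_cons, if_pos hp1, Finset.card_cons,
          Finset.filter_map, Finset.card_map] at htot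
        have hle : (Finset.univ.filter fun j : Fin m => p ≤ (π j.castSucc).val).card + 1 + p ≤ n :=
          htot
        omega
      classical
      have hne : (Finset.univ.filter fun s : Fin n =>
          π (Fin.last m) ≤ s ∧ ∀ j, σ j ≠ s).Nonempty := by
        obtain ⟨s, hs⟩ := hfree
        exact ⟨s, by simpa using hs⟩
      refine ⟨Fin.snoc (α := fun _ => Fin n) σ (Finset.min' _ hne), fun i => ?_⟩
      induction i using Fin.lastCases with
      | last =>
        rw [Fin.snoc_last]
        have hleast := Finset.isLeast_min' _ hne
        have hset : {s : Fin n | π (Fin.last m) ≤ s ∧ ∀ j, j < Fin.last m →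
            Fin.snoc (α := fun _ => Fin n) σ (Finset.min' _ hne) j ≠ s} =
            ↑(Finset.univ.filter fun s : Fin n => π (Fin.last m) ≤ s ∧ ∀ j, σ j ≠ s) := by
          ext s
          simp [Fin.forall_fin_succ']
        rw [hset]
        exact hleast
      | cast i =>
        rw [Fin.snoc_castSucc]
        have hset : {s : Fin n | π i.castSucc ≤ s ∧ ∀ j, j < i.castSucc →
            Fin.snoc (α := fun _ => Fin n) σ (Finset.min' _ hne) j ≠ s} =
            {s : Fin n | π i.castSucc ≤ s ∧ ∀ j, j < i → σ j ≠ s} := by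
          ext s
          simp [Fin.forall_fin_succ', Fin.castSucc_lt_castSucc_iff,
            not_lt.2 (Fin.le_last i.castSucc)]
        rw [hset]
        exact hσ i

/-! ### Cycle lemma and rotations -/

/-- The cycle lemma: a sequence of integers with steps at most `1` that increases by `b` over each
period of length `n` has exactly `b` records in a period. -/
theorem card_records_eq {n b : ℕ} (hn : 0 < n) (S : ℕ → ℤ) (hstep : ∀ k, S (k + 1) ≤ S k + 1)
    (hper : ∀ k, S (k + n) = S k + b) :
    ((Finset.range n).filter fun k => ∀ y < n, S (k + y) < S (k + n)).card = b := by
  have hne : (Finset.range n).Nonempty := Finset.nonempty_range_iff.2 hn.ne'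
  -- The maximum over the window `[k, k + n)` grows by `1` at a record and by `0` otherwise; over
  -- one period the growth telescopes to `b`.
  let M : ℕ → ℤ := fun k => (Finset.range n).sup' hne fun y => S (k + y)
  have hle : ∀ k y, y < n → S (k + y) ≤ M k := fun k y hy =>
    Finset.le_sup' (fun y => S (k + y)) (Finset.mem_range.2 hy)
  have hM_le : ∀ k c, (∀ y < n, S (k + y) ≤ c) → M k ≤ c := fun k c h =>
    Finset.sup'_le _ _ fun y hy => h y (Finset.mem_range.1 hy)
  have hshift : ∀ k, S (k + n) ≤ M (k + 1) := fun k => by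
    have := hle (k + 1) (n - 1) (by omega)
    rwa [show k + 1 + (n - 1) = k + n by omega] at this
  have hnext : ∀ k c, M k ≤ c → S (k + n) ≤ c → M (k + 1) ≤ c := fun k c h1 h2 => by
    refine hM_le _ _ fun y hy => ?_
    rcases Nat.lt_or_ge (y + 1) n with h | h
    · rw [show k + 1 + y = k + (y + 1) by omega]
      exact (hle k (y + 1) h).trans h1
    · rwa [show k + 1 + y = k + n by omega]
  have hrec : ∀ k, M (k + 1) - M k = if ∀ y < n, S (k + y) < S (k + n) then 1 else 0 := by
    intro k
    split_ifs with h
    · have h1 : M k ≤ S (k + n) - 1 := hM_le _ _ fun y hy => by have := h y hy; omega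
      have h2 : S (k + n) ≤ M k + 1 := by
        have h3 := hle k (n - 1) (by omega)
        have h4 := hstep (k + (n - 1))
        rw [show k + (n - 1) + 1 = k + n by omega] at h4
        omega
      have h5 := hnext k (M k + 1) (by omega) h2
      have h6 := hshift k
      omega
    · push Not at h
      obtain ⟨y, hy, hy'⟩ := h
      have h1 := hnext k (M k) le_rfl (hy'.trans (hle k y hy))
      have h2 : M k ≤ M (k + 1) := hM_le _ _ fun z hz => by
        rcases Nat.eq_zero_or_pos z with rfl | hz0
        -- The value leaving the window is at most the one entering it, since `b ≥ 0`.
        · have h3 := hper k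
          have h4 := hshift k
          rw [add_zero]
          omega
        · have := hle (k + 1) (z - 1) (by omega)
          rwa [show k + 1 + (z - 1) = k + z by omega] at this
      omega
  have hMn : M n = M 0 + b := by
    refine le_antisymm (hM_le _ _ fun y hy => ?_) ?_
    · have := hle 0 y hy
      have h2 := hper y
      rw [zero_add] at this
      rw [add_comm n y]
      omega
    · rw [← le_sub_iff_add_le]
      refine hM_le _ _ fun y hy => ?_
      have := hle n y hy
      have h2 := hper y
      rw [add_comm n y] at this
      rw [zero_add]
      omega
  have htel := Finset.sum_range_sub M n
  simp only [hrec, Finset.sum_boole, hMn] at htel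
  have : (((Finset.range n).filter fun k => ∀ y < n, S (k + y) < S (k + n)).card : ℤ) = b := by
    rw [htel]; ring
  exact_mod_cast this

/-- If `n - b` cars have their preferences counted by `w` on a circle of `n` spots, then `b` of the
`n` rotations of `w` leave every final segment of the spots underfull. -/
theorem card_rotations_eq {n b : ℕ} [NeZero n] (w : Fin n → ℕ) (hw : ∑ z, w z + b = n) :
    (Finset.univ.filter fun c : Fin n =>
      ∀ y < n, (∑ z with y ≤ z.val, w (z + c)) + y + 1 ≤ n).card = b := by
  have hn : 0 < n := NeZero.pos n
  -- Spots minus cars along the unrolled circle: rotation by `c` is good exactly when `S (c + n)`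
  -- exceeds every `S (c + y)` with `y < n`, a record.
  let S : ℕ → ℤ := fun k => ∑ i ∈ Finset.range k, (1 - (w (Fin.ofNat n i) : ℤ))
  have hsum : ∀ k, ∀ y ≤ n, S (k + n) - S (k + y) =
      (n - y) - ∑ z ∈ Finset.Ico y n, (w (Fin.ofNat n (z + k)) : ℤ) := by
    intro k y hy
    rw [← Finset.sum_Ico_eq_sub _ (by omega : k + y ≤ k + n), add_comm k n, add_comm k y,
      ← Finset.sum_Ico_add' (fun i => (1 - (w (Fin.ofNat n i) : ℤ))), Finset.sum_sub_distrib]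
    simp [Nat.cast_sub hy]
  have hfin : ∀ c : Fin n, ∀ y, ∑ z with y ≤ z.val, w (z + c) =
      ∑ z ∈ Finset.Ico y n, w (Fin.ofNat n (z + c.val)) := by
    intro c y
    have h1 : ∀ z : Fin n, z + c = Fin.ofNat n (z.val + c.val) := fun z => by
      ext; simp [Fin.val_add]
    simp only [h1]
    rw [Finset.sum_filter,
      Fin.sum_univ_eq_sum_range (fun i => if y ≤ i then w (Fin.ofNat n (i + c.val)) else 0) n,
      ← Finset.sum_filter]
    refine Finset.sum_congr ?_ fun _ _ => rfl
    ext i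
    simp [and_comm]
  have hper : ∀ k, S (k + n) = S k + b := by
    intro k
    have h1 := hsum k 0 (Nat.zero_le n)
    have h2 := hfin (Fin.ofNat n k) 0
    have h3 : ∑ z : Fin n with 0 ≤ z.val, w (z + Fin.ofNat n k) = ∑ z, w z := by
      rw [Finset.filter_true_of_mem fun _ _ => Nat.zero_le _]
      exact Equiv.sum_comp (Equiv.addRight (Fin.ofNat n k)) w
    have h4 : ∀ z, Fin.ofNat n (z + (Fin.ofNat n k).val) = Fin.ofNat n (z + k) := fun z => by
      ext; simp
    simp only [h4] at h2
    rw [h3] at h2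
    have h5 : ((∑ z, w z : ℕ) : ℤ) + b = n := by exact_mod_cast hw
    rw [h2] at h5
    push_cast at h5
    rw [add_zero] at h1
    push_cast at h1
    linarith
  have hrec := card_records_eq (b := b) hn S (fun k => by
    simp only [S, Finset.sum_range_succ]
    have : (0 : ℤ) ≤ w (Fin.ofNat n k) := Int.natCast_nonneg _
    linarith) hper
  rw [← hrec]
  refine Finset.card_nbij Fin.val ?_ Fin.val_injective.injOn ?_
  · intro c hc
    simp only [Finset.coe_filter, Finset.mem_univ, true_and, Finset.mem_range, Set.mem_ofPred_eq] at hc ⊢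
    refine ⟨c.isLt, fun y hy => ?_⟩
    have h1 := hsum c y hy.le
    have h2 := hc y hy
    rw [hfin] at h2
    zify at h2
    linarith
  · intro k hk
    simp only [Finset.coe_filter, Finset.mem_range, Set.mem_ofPred_eq] at hk
    refine ⟨⟨k, hk.1⟩, ?_, rfl⟩
    simp only [Finset.coe_filter, Finset.mem_univ, true_and, Set.mem_ofPred_eq]
    intro y hy
    have h1 := hsum k y hy.le
    have h2 := hk.2 y hy
    rw [hfin]
    zify
    linarith

/-! ### Reduced partition as the fibres of the merged list -/

/-- The preference list obtained by letting all cars that prefer the first spot change their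
preference to that of the first car. -/
def mergeFirst {n : ℕ} [NeZero n] (π : Fin n → Fin n) (j : Fin n) : Fin n :=
  if π j = 0 then π 0 else π j

theorem part_reducedPreferencePartition {n : ℕ} [NeZero n] (π : Fin n → Fin n) (j : Fin n) :
    (reducedPreferencePartition π).part j =
      Finset.univ.filter fun i => mergeFirst π i = mergeFirst π j := by
  refine Finpartition.part_eq_of_mem _ ?_ (by simp)
  by_cases hj : π j = 0 ∨ π j = π 0
  · have h1 : mergeFirst π j = π 0 := by
      unfold mergeFirst
      rcases hj with h | h <;> simp [h]
    refine Finset.mem_insert.2 (Or.inl ?_)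
    ext i
    simp only [Finset.mem_filter, Finset.mem_univ, true_and, Finset.mem_union,
      mem_preferenceBlock, h1]
    unfold mergeFirst
    split_ifs with h <;> simp [h]
  · push Not at hj
    have h1 : mergeFirst π j = π j := if_neg hj.1
    have h2 : (Finset.univ.filter fun i => mergeFirst π i = mergeFirst π j) =
        preferenceBlock π (π j) := by
      ext i
      simp only [Finset.mem_filter, Finset.mem_univ, true_and, mem_preferenceBlock, h1]
      unfold mergeFirst
      split_ifs with h
      · simp [h, hj.1.symm, hj.2.symm]
      · rfl
    have hmem : j ∈ preferenceBlock π (π j) := mem_preferenceBlock.2 rfl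
    rw [h2]
    refine Finset.mem_insert.2 (Or.inr (Finset.mem_sdiff.2 ⟨?_, ?_⟩))
    · exact Finset.mem_erase.2 ⟨Finset.ne_empty_of_mem hmem,
        Finset.mem_image_of_mem _ (Finset.mem_univ _)⟩
    · rw [Finset.mem_insert, Finset.mem_singleton]
      rintro (h | h)
      · exact hj.1 (mem_preferenceBlock.1 (h ▸ hmem))
      · exact hj.2 (mem_preferenceBlock.1 (h ▸ hmem))

theorem reducedPreferencePartition_eq_iff {n : ℕ} [NeZero n] (π : Fin n → Fin n)
    (P : Finpartition (Finset.univ : Finset (Fin n))) :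
    reducedPreferencePartition π = P ↔
      ∀ i j, mergeFirst π i = mergeFirst π j ↔ P.part i = P.part j := by
  have hpart : ∀ (Q : Finpartition (Finset.univ : Finset (Fin n))) i j,
      i ∈ Q.part j ↔ Q.part i = Q.part j := fun Q i j =>
    Q.mem_part_iff_part_eq_part (Finset.mem_univ _) (Finset.mem_univ _)
  constructor
  · rintro rfl i j
    rw [← hpart, part_reducedPreferencePartition]
    simp
  · intro h
    have heq : ∀ j, (reducedPreferencePartition π).part j = P.part j := by
      intro j
      ext i
      rw [part_reducedPreferencePartition, hpart, ← h]
      simp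
    have hparts : ∀ (Q : Finpartition (Finset.univ : Finset (Fin n))) t,
        t ∈ Q.parts ↔ ∃ j, Q.part j = t := fun Q t =>
      ⟨fun ht => (Q.part_surjOn ht).imp fun j hj => hj.2,
        by rintro ⟨j, rfl⟩; exact Q.part_mem.2 (Finset.mem_univ j)⟩
    ext t
    simp only [hparts, heq]

/-! ### Counting block labelings by rotation -/

/-- The labelings of the blocks of `P` by distinct elements of `Fin n`, as functions on `Fin n`. -/
def blockLabelings {n : ℕ} (P : Finpartition (Finset.univ : Finset (Fin n))) :
    Finset (Fin n → Fin n) :=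
  Finset.univ.filter fun h => ∀ i j, h i = h j ↔ P.part i = P.part j

theorem mem_blockLabelings {n : ℕ} {P : Finpartition (Finset.univ : Finset (Fin n))}
    {h : Fin n → Fin n} :
    h ∈ blockLabelings P ↔ ∀ i j, h i = h j ↔ P.part i = P.part j := by
  simp [blockLabelings]

/-- Every final segment of the spots is preferred, under `h`, by fewer cars outside `B` than it has
spots. -/
def IsUnderfull {n : ℕ} (B : Finset (Fin n)) (h : Fin n → Fin n) : Prop :=
  ∀ y < n, (Finset.univ.filter fun j => j ∉ B ∧ y ≤ (h j).val).card + y + 1 ≤ n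

open Classical in
theorem card_rotations_isUnderfull {n : ℕ} [NeZero n] (B : Finset (Fin n)) (h : Fin n → Fin n) :
    (Finset.univ.filter fun c => IsUnderfull B fun j => h j - c).card = B.card := by
  let w : Fin n → ℕ := fun z => (Finset.univ.filter fun j => j ∉ B ∧ h j = z).card
  have hw : ∑ z, w z + B.card = n := by
    have h1 := Finset.card_eq_sum_card_fiberwise (f := h) (s := Bᶜ) (t := Finset.univ)
      (by simp)
    have h2 := Finset.card_add_card_compl B
    rw [Fintype.card_fin, h1, add_comm] at h2
    refine Eq.trans (congrArg (· + B.card) ?_) h2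
    refine Finset.sum_congr rfl fun z _ => congrArg Finset.card ?_
    ext j
    simp
  rw [← card_rotations_eq w hw]
  congr 1
  ext c
  simp only [Finset.mem_filter, Finset.mem_univ, true_and]
  refine forall₂_congr fun y _ => ?_
  have h1 := Finset.card_eq_sum_card_fiberwise (f := fun j => h j - c)
    (s := Finset.univ.filter fun j => j ∉ B ∧ y ≤ (h j - c).val)
    (t := Finset.univ.filter fun z : Fin n => y ≤ z.val)
    (by intro j hj; simp at hj ⊢; exact hj.2)
  rw [h1]
  have h2 : ∀ z ∈ Finset.univ.filter fun z : Fin n => y ≤ z.val,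
      ((Finset.univ.filter fun j => j ∉ B ∧ y ≤ (h j - c).val).filter
        fun j => h j - c = z).card = w (z + c) := by
    intro z hz
    simp only [Finset.mem_filter, Finset.mem_univ, true_and] at hz
    refine congrArg _ ?_
    ext j
    simp only [Finset.mem_filter, Finset.mem_univ, true_and, sub_eq_iff_eq_add]
    constructor
    · rintro ⟨⟨h3, -⟩, h4⟩
      exact ⟨h3, h4⟩
    · rintro ⟨h3, h4⟩
      exact ⟨⟨h3, by rwa [h4, add_sub_cancel_right]⟩, h4⟩
  rw [Finset.sum_congr rfl h2]

-- Double counting of pairs (labeling, rotation): rotations permute the labelings, and each labeling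
-- has `B.card` good rotations.
open Classical in
theorem mul_card_isUnderfull {n : ℕ} [NeZero n] (P : Finpartition (Finset.univ : Finset (Fin n)))
    (B : Finset (Fin n)) :
    n * ((blockLabelings P).filter (IsUnderfull B)).card = (blockLabelings P).card * B.card := by
  have h1 : ∀ c : Fin n, ((blockLabelings P).filter fun h => IsUnderfull B fun j => h j - c).card =
      ((blockLabelings P).filter (IsUnderfull B)).card := by
    intro c
    refine Finset.card_nbij' (fun h j => h j - c) (fun h j => h j + c) ?_ ?_ ?_ ?_
    · intro h hh
      simpa [mem_blockLabelings] using hh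
    · intro h hh
      simpa [mem_blockLabelings] using hh
    · intro h _
      simp
    · intro h _
      simp
  calc n * ((blockLabelings P).filter (IsUnderfull B)).card
      = ∑ c : Fin n, ((blockLabelings P).filter fun h => IsUnderfull B fun j => h j - c).card := by
        simp [h1]
    _ = ∑ h ∈ blockLabelings P,
          (Finset.univ.filter fun c => IsUnderfull B fun j => h j - c).card := by
        simp only [Finset.card_filter]
        exact Finset.sum_comm
    _ = (blockLabelings P).card * B.card := by
        simp [card_rotations_isUnderfull]

open Classical in
/-- The parking functions in which the first car does not prefer the first spot, with given
reduced preference partition and given set `B` of cars preferring the first spot, correspond to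
the block labelings that are underfull outside `B`. -/
theorem card_isParkingFunction_of_block {n : ℕ} [NeZero n]
    (P : Finpartition (Finset.univ : Finset (Fin n))) {B : Finset (Fin n)}
    (hB : B ⊆ (P.part 0).erase 0) :
    (Finset.univ.filter fun π : Fin n → Fin n => IsParkingFunction π ∧
      reducedPreferencePartition π = P ∧ preferenceBlock π 0 = B).card =
      ((blockLabelings P).filter (IsUnderfull B)).card := by
  have h0 : (0 : Fin n) ∉ B := fun h => Finset.notMem_erase _ _ (hB h)
  have hBpart : ∀ j ∈ B, P.part j = P.part 0 := fun j hj =>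
    (P.mem_part_iff_part_eq_part (Finset.mem_univ _) (Finset.mem_univ _)).1
      (Finset.mem_of_mem_erase (hB hj))
  have hsucc : ∀ h : Fin n → Fin n, IsUnderfull B h → ∀ j ∉ B,
      (h j + 1).val = (h j).val + 1 := by
    intro h hh j hj
    refine Fin.val_add_one_of_lt' ?_
    -- Car `j` itself counts in the segment starting at `h j`, so `h j + 2 ≤ n` and adding `1` does
    -- not wrap around.
    have h1 := hh (h j).val (h j).isLt
    have h2 : 0 < (Finset.univ.filter fun i => i ∉ B ∧ (h j).val ≤ (h i).val).card :=
      Finset.card_pos.2 ⟨j, by simp [hj]⟩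
    omega
  have hzero : ∀ h : Fin n → Fin n, IsUnderfull B h → ∀ j ∉ B, h j + 1 ≠ 0 := by
    intro h hh j hj he
    have := hsucc h hh j hj
    rw [he] at this
    simp at this
  refine Finset.card_nbij' (fun π j => mergeFirst π j - 1)
    (fun h j => if j ∈ B then 0 else h j + 1) ?_ ?_ ?_ ?_
  · intro π hπ
    simp only [Finset.coe_filter, Finset.mem_univ, true_and, Set.mem_ofPred_eq] at hπ ⊢
    obtain ⟨hpark, hred, rfl⟩ := hπ
    rw [reducedPreferencePartition_eq_iff] at hred
    refine ⟨by simpa [mem_blockLabelings] using hred, fun y hy => ?_⟩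
    -- The shift turns the parking bound at `y + 1` into the underfull bound at `y`; the bound at
    -- `0` is automatic.
    have h1 := (isParkingFunction_iff π).1 hpark (y + 1) hy
    rw [add_assoc]
    refine le_trans (Nat.add_le_add_right (Finset.card_le_card ?_) _) h1
    intro j
    simp only [Finset.mem_filter, Finset.mem_univ, true_and, mem_preferenceBlock]
    rintro ⟨hj, hyj⟩
    rw [mergeFirst, if_neg hj, Fin.val_sub_one_of_ne_zero hj] at hyj
    have : (π j).val ≠ 0 := fun h => hj (Fin.ext (by simpa using h))
    omega
  · intro h hh
    simp only [Finset.coe_filter, Finset.mem_univ, true_and, Set.mem_ofPred_eq] at hh ⊢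
    obtain ⟨hlab, hund⟩ := hh
    rw [mem_blockLabelings] at hlab
    have hmerge : ∀ j, mergeFirst (fun j => if j ∈ B then 0 else h j + 1) j = h j + 1 := by
      intro j
      by_cases hj : j ∈ B
      -- Merging restores the label of `B`, which lies in the block of car `0` while car `0` is
      -- outside `B`.
      · simp [mergeFirst, hj, h0, (hlab j 0).2 (hBpart j hj)]
      · simp [mergeFirst, hj, hzero h hund j hj]
    refine ⟨?_, ?_, ?_⟩
    · rw [isParkingFunction_iff]
      intro p hp
      rcases p with _ | y
      · simp
      · refine le_trans (Nat.add_le_add_right (Finset.card_le_card ?_) _) (hund y hp)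
        intro j
        simp only [Finset.mem_filter, Finset.mem_univ, true_and]
        split_ifs with hj
        · simp
        · rw [hsucc h hund j hj]
          exact fun h3 => ⟨hj, by omega⟩
    · rw [reducedPreferencePartition_eq_iff]
      simpa [hmerge] using hlab
    · ext j
      rw [mem_preferenceBlock]
      by_cases hj : j ∈ B
      · simp [hj]
      · simp [hj, hzero h hund j hj]
  · intro π hπ
    simp only [Finset.coe_filter, Finset.mem_univ, true_and, Set.mem_ofPred_eq] at hπ
    obtain ⟨-, -, rfl⟩ := hπ
    funext j
    by_cases hj : π j = 0
    · simp [mem_preferenceBlock, hj]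
    · simp [mem_preferenceBlock, hj, mergeFirst]
  · intro h hh
    simp only [Finset.coe_filter, Set.mem_ofPred_eq] at hh
    obtain ⟨hlab, hund⟩ := hh
    rw [mem_blockLabelings] at hlab
    funext j
    by_cases hj : j ∈ B
    · simp [mergeFirst, hj, h0, (hlab j 0).2 (hBpart j hj)]
    · simp [mergeFirst, hj, hzero h hund j hj]

/-! ### Joint counts and symmetry -/

theorem lel_eq_ones_of_apply_zero {n : ℕ} [NeZero n] {π : Fin n → Fin n} (h : π 0 = 0) :
    lel π = ones π := by
  simp [lel, ones, h]

theorem preferenceBlock_zero_subset {n : ℕ} [NeZero n] {π : Fin n → Fin n} (h : π 0 ≠ 0) :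
    preferenceBlock π 0 ⊆ ((reducedPreferencePartition π).part 0).erase 0 := by
  intro j hj
  rw [mem_preferenceBlock] at hj
  rw [Finset.mem_erase, part_reducedPreferencePartition]
  refine ⟨fun h0 => h (h0 ▸ hj), ?_⟩
  simp [mergeFirst, hj]

theorem lel_add_ones {n : ℕ} [NeZero n] {π : Fin n → Fin n} (h : π 0 ≠ 0) :
    lel π + ones π = ((reducedPreferencePartition π).part 0).card := by
  rw [lel, ones, ← Finset.card_union_of_disjoint, part_reducedPreferencePartition]
  · congr 1
    ext j
    simp only [Finset.mem_union, Finset.mem_filter, Finset.mem_univ, true_and, mergeFirst]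
    by_cases hj : π j = 0 <;> simp [hj]
  · rw [Finset.disjoint_filter]
    intro j _ h1 h2
    exact h (h1.symm.trans h2)

open Classical in
theorem mul_card_isParkingFunction {n : ℕ} [NeZero n]
    (P : Finpartition (Finset.univ : Finset (Fin n))) {s t : ℕ} (hst : s ≠ t)
    (hP : s + t = (P.part 0).card) :
    n * (Finset.univ.filter fun π : Fin n → Fin n => IsParkingFunction π ∧
      reducedPreferencePartition π = P ∧ lel π = s ∧ ones π = t).card =
      (blockLabelings P).card * (((P.part 0).card - 1).choose t * t) := by
  -- Split by `B`, a `t`-subset of the block of car `0` that avoids car `0`; each choice contributes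
  -- equally.
  rw [Finset.card_eq_sum_card_fiberwise (f := fun π => preferenceBlock π 0)
    (t := ((P.part 0).erase 0).powersetCard t)]
  · have h1 : ∀ B ∈ ((P.part 0).erase 0).powersetCard t,
        n * ((Finset.univ.filter fun π : Fin n → Fin n => IsParkingFunction π ∧
          reducedPreferencePartition π = P ∧ lel π = s ∧ ones π = t).filter
          fun π => preferenceBlock π 0 = B).card = (blockLabelings P).card * t := by
      intro B hB
      obtain ⟨hB, hBt⟩ := Finset.mem_powersetCard.1 hB
      have h2 := mul_card_isUnderfull P B
      rw [← card_isParkingFunction_of_block P hB, hBt] at h2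
      rw [← h2]
      congr 2
      ext π
      simp only [Finset.mem_filter, Finset.mem_univ, true_and]
      constructor
      · rintro ⟨⟨h3, h4, -, -⟩, h5⟩
        exact ⟨h3, h4, h5⟩
      · rintro ⟨h3, h4, h5⟩
        have h6 : π 0 ≠ 0 := fun h =>
          Finset.notMem_erase _ _ (hB (h5 ▸ mem_preferenceBlock.2 h))
        have h7 : ones π = t := by rw [← hBt, ← h5]; rfl
        have h8 := lel_add_ones h6
        rw [h4] at h8
        exact ⟨⟨h3, h4, by omega, h7⟩, h5⟩
    rw [Finset.mul_sum, Finset.sum_congr rfl h1, Finset.sum_const, Finset.card_powersetCard,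
      Finset.card_erase_of_mem (P.mem_part (Finset.mem_univ 0)), smul_eq_mul]
    ring
  · intro π hπ
    simp only [Finset.coe_filter, Finset.mem_univ, true_and, Set.mem_ofPred_eq] at hπ
    obtain ⟨-, rfl, rfl, rfl⟩ := hπ
    exact Finset.mem_powersetCard.2
      ⟨preferenceBlock_zero_subset fun h => hst (lel_eq_ones_of_apply_zero h), rfl⟩

theorem choose_mul_eq_choose_mul {r s t : ℕ} (h : s + t = r) :
    (r - 1).choose t * t = (r - 1).choose s * s := by
  rcases s with _ | s
  · rcases t with _ | t
    · rfl
    · rw [Nat.choose_eq_zero_of_lt (by omega)]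
      simp
  rcases t with _ | t
  · rw [Nat.choose_eq_zero_of_lt (by omega : r - 1 < s + 1)]
    simp
  rw [Nat.choose_succ_right_eq, Nat.choose_symm_of_eq_add (by omega : r - 1 = t + (s + 1)),
    show r - 1 - t = s + 1 by omega]

theorem theorem6p1 (n : ℕ) [NeZero n] (P : Finpartition (Finset.univ : Finset (Fin n)))
    (s t : ℕ) :
    {π : Fin n → Fin n | IsParkingFunction π ∧ reducedPreferencePartition π = P ∧
        lel π = s ∧ ones π = t}.ncard =
      {π : Fin n → Fin n | IsParkingFunction π ∧ reducedPreferencePartition π = P ∧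
        lel π = t ∧ ones π = s}.ncard := by
  classical
  rcases eq_or_ne s t with rfl | hst
  · rfl
  by_cases hP : s + t = (P.part 0).card
  · have hcard : ∀ a b : ℕ, {π : Fin n → Fin n | IsParkingFunction π ∧
        reducedPreferencePartition π = P ∧ lel π = a ∧ ones π = b}.ncard =
        (Finset.univ.filter fun π : Fin n → Fin n => IsParkingFunction π ∧
          reducedPreferencePartition π = P ∧ lel π = a ∧ ones π = b).card := fun a b => by
      rw [← Set.ncard_coe_finset, Finset.coe_filter]
      simp
    rw [hcard, hcard]
    refine Nat.eq_of_mul_eq_mul_left (NeZero.pos n) ?_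
    rw [mul_card_isParkingFunction P hst hP,
      mul_card_isParkingFunction P hst.symm ((add_comm t s).trans hP),
      choose_mul_eq_choose_mul hP]
  · have hempty : ∀ a b : ℕ, a ≠ b → a + b ≠ (P.part 0).card →
        {π : Fin n → Fin n | IsParkingFunction π ∧
          reducedPreferencePartition π = P ∧ lel π = a ∧ ones π = b} = ∅ := by
      intro a b hab hne
      refine Set.eq_empty_of_forall_notMem ?_
      rintro π ⟨-, rfl, rfl, rfl⟩
      exact hne (lel_add_ones fun h => hab (lel_eq_ones_of_apply_zero h))
    rw [hempty s t hst hP, hempty t s hst.symm (by rwa [add_comm])]
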